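/- Let $n\le m$, let $\mu=\mathcal N(m_0,\Sigma_0)$ be a Gaussian measure on $\mathbb R^m$ with non-singular covariance matrix $\Sigma_0$, and let $\nu=\mathcal N(m_1,\Sigma_1)$ be a (possibly degenerate) Gaussian measure on $\mathbb R^n$. Let $\Pi(\mu,\nu)$ be the set of measures on $\mathbb R^m\times\mathbb R^n$ with marginals $\mu$ and $\nu$, let $\mathcal N_{m+n}$ be the set of (possibly degenerate) Gaussian measures on $\mathbb R^{m+n}=\mathbb R^m\times\mathbb R^n$, and put $$GW_2^2(\mu,\nu)=\inf_{\pi\in\Pi(\mu,\nu)}\iint\left(\|x-x'\|^2-\|y-y'\|^2\right)^2d\pi(x,y)\,d\pi(x',y'),$$ $$GGW_2^2(\mu,\nu)=\inf_{\pi\in\Pi(\mu,\nu)\cap\mathcal N_{m+n}}\iint\left(\|x-x'\|^2-\|y-y'\|^2\right)^2d\pi(x,y)\,d\pi(x',y'),$$ with Euclidean norms. Let $\Sigma_0=P_0D_0P_0^T$ and $\Sigma_1=P_1D_1P_1^T$ be diagonalizations with $P_0,P_1$ orthogonal and $D_0,D_1$ diagonal with diagonal entries in decreasing order, let $D_0^{(n)}$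 be the submatrix of the first $n$ rows and the first $n$ columns of $D_0$, and put, with $\|\cdot\|_{\mathcal F}$ the Frobenius norm, $$LGW_2^2(\mu,\nu)=4\left(\operatorname{tr}D_0-\operatorname{tr}D_1\right)^2+4\left(\|D_0\|_{\mathcal F}-\|D_1\|_{\mathcal F}\right)^2+4\|D_0^{(n)}-D_1\|_{\mathcal F}^2+4\left(\|D_0\|_{\mathcal F}^2-\|D_0^{(n)}\|_{\mathcal F}^2\right).$$ Then $$LGW_2^2(\mu,\nu)\le GW_2^2(\mu,\nu)\le GGW_2^2(\mu,\nu)<\infty.$$ -/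

import Mathlib

open MeasureTheory ProbabilityTheory
open scoped ENNReal

namespace GromovGauss

/-- The set `Π(μ, ν)` of couplings of `μ` and `ν`: measures on the product space with first
marginal `μ` and second marginal `ν`. -/
def couplings {m n : ℕ} (μ : Measure (EuclideanSpace ℝ (Fin m)))
    (ν : Measure (EuclideanSpace ℝ (Fin n))) :
    Set (Measure (EuclideanSpace ℝ (Fin m) × EuclideanSpace ℝ (Fin n))) :=
  {π | π.map Prod.fst = μ ∧ π.map Prod.snd = ν}

/-- The quadratic Gromov-Wasserstein cost of a plan `π`,
`∫∫ (‖x - x'‖² - ‖y - y'‖²)² dπ(x,y) dπ(x',y')`, as an element of `[0, ∞]`. -/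
noncomputable def gwCost {m n : ℕ}
    (π : Measure (EuclideanSpace ℝ (Fin m) × EuclideanSpace ℝ (Fin n))) : ℝ≥0∞ :=
  ∫⁻ p, ∫⁻ q, ENNReal.ofReal ((‖p.1 - q.1‖ ^ 2 - ‖p.2 - q.2‖ ^ 2) ^ 2) ∂π ∂π

/-- `GW₂²(μ, ν)`: the infimum of the cost over all couplings. -/
noncomputable def GWSq {m n : ℕ} (μ : Measure (EuclideanSpace ℝ (Fin m)))
    (ν : Measure (EuclideanSpace ℝ (Fin n))) : ℝ≥0∞ :=
  ⨅ π ∈ couplings μ ν, gwCost π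

/-- `GGW₂²(μ, ν)`: the infimum of the cost over all couplings that are Gaussian measures
(possibly degenerate) on the product space. -/
noncomputable def GGWSq {m n : ℕ} (μ : Measure (EuclideanSpace ℝ (Fin m)))
    (ν : Measure (EuclideanSpace ℝ (Fin n))) : ℝ≥0∞ :=
  ⨅ π ∈ couplings μ ν ∩ {π | IsGaussian π}, gwCost π

/-- `S = P D Pᵀ` with `P` orthogonal and `D` diagonal with diagonal entries in decreasing
(that is, non-increasing) order. -/
structure IsSortedDiagonalization {k : ℕ} (S P D : Matrix (Fin k) (Fin k) ℝ) : Prop where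
  orthogonal : P ∈ Matrix.orthogonalGroup (Fin k) ℝ
  isDiag : D.IsDiag
  antitone : Antitone D.diag
  eq_mul : S = P * D * P.transpose

/-- `A⁽ⁿ⁾`: the submatrix of the first `n` rows and the first `n` columns of `A`. -/
def leadingBlock {m n : ℕ} (hnm : n ≤ m) (A : Matrix (Fin m) (Fin m) ℝ) :
    Matrix (Fin n) (Fin n) ℝ :=
  A.submatrix (Fin.castLE hnm) (Fin.castLE hnm)

open scoped Matrix.Norms.Frobenius in
/-- `LGW₂²`, expressed through the sorted diagonal matrices `D₀`, `D₁` of eigenvalues of the two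
covariance matrices; the norms are Frobenius norms. -/
noncomputable def LGWSq {m n : ℕ} (hnm : n ≤ m) (D₀ : Matrix (Fin m) (Fin m) ℝ)
    (D₁ : Matrix (Fin n) (Fin n) ℝ) : ℝ :=
  4 * (D₀.trace - D₁.trace) ^ 2 + 4 * (‖D₀‖ - ‖D₁‖) ^ 2 + 4 * ‖leadingBlock hnm D₀ - D₁‖ ^ 2
    + 4 * (‖D₀‖ ^ 2 - ‖leadingBlock hnm D₀‖ ^ 2)

end GromovGauss

/-! Centre both marginals and pass to eigenbases: a coupling becomes a pair `(X, Y)` whose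
components have independent Gaussian coordinates with variances `a` and `b`, the diagonals of `D₀`
and `D₁`, while the joint law stays arbitrary. Expanding the square and applying Fubini
(`integrable_integral_sq_signed_sum`, `gwCost_eq`) leaves, besides terms fixed by the marginals,
only `-4 E[‖X‖²‖Y‖²] - 8 ‖K‖²` with `K` the cross-covariance and `‖K‖` its Frobenius norm.

Each term is bounded separately. Since `Var ‖X‖² = 2 ∑ aᵢ²`, Cauchy–Schwarz gives `E[‖X‖²‖Y‖²] ≤ tr
D₀ tr D₁ + 2 ‖D₀‖ ‖D₁‖` (`integral_mul_sum_sq_le`). Bessel's inequality makes `Kᵢⱼ² / (aᵢ bⱼ)`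
doubly substochastic, so a rearrangement inequality gives `‖K‖² ≤ ∑ aⱼ bⱼ` (`sum_sq_crossCov_le`).
Inserting both bounds yields exactly `LGWSq` (`LGWSq_eq`). Finiteness comes from the product
coupling, which is Gaussian. -/

namespace GromovGauss

/-! ### Second and fourth moments of a real Gaussian -/

section Moments

open scoped NNReal in
/-- The fourth moment of a centred real Gaussian measure. -/
lemma integral_pow_four_gaussianReal (v : ℝ≥0) :
    ∫ x, x ^ 4 ∂gaussianReal 0 v = 3 * (v : ℝ) ^ 2 := by
  -- Differentiating `p · exp(v t² / 2)` replaces the polynomial `p` by `p' + v t p`; four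
  -- iterations from `p = 1` give a polynomial with constant term `3 v²`.
  have key : ∀ p p' : ℝ → ℝ, (∀ t, HasDerivAt p (p' t) t) →
      deriv (fun t ↦ p t * Real.exp (v * t ^ 2 / 2)) =
        fun t ↦ (p' t + v * t * p t) * Real.exp (v * t ^ 2 / 2) := by
    intro p p' hp
    ext t
    have h1 : HasDerivAt (fun t : ℝ ↦ (v : ℝ) * t ^ 2 / 2) (v * t) t :=
      (((hasDerivAt_pow 2 t).const_mul (v : ℝ)).div_const 2).congr_deriv (by norm_num; ring)
    exact (((hp t).mul h1.exp).congr_deriv (by ring)).deriv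
  have h := iteratedDeriv_mgf_zero (X := fun x : ℝ ↦ x) (μ := gaussianReal 0 v) (by simp) 4
  have h' : ∫ x, x ^ 4 ∂gaussianReal 0 v = iteratedDeriv 4 (mgf (fun x ↦ x) (gaussianReal 0 v)) 0 := by
    rw [h]; rfl
  rw [h', mgf_fun_id_gaussianReal]
  have e0 : (fun t : ℝ ↦ Real.exp (0 * t + v * t ^ 2 / 2)) =
      fun t ↦ (fun _ ↦ (1 : ℝ)) t * Real.exp (v * t ^ 2 / 2) := by ext; simp
  rw [e0, iteratedDeriv_succ', key _ (fun _ ↦ 0) fun t ↦ hasDerivAt_const _ _, iteratedDeriv_succ',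
    key (fun t ↦ 0 + v * t * 1) (fun _ ↦ v) ?_, iteratedDeriv_succ',
    key (fun t ↦ v + v * t * (0 + v * t * 1)) (fun t ↦ 2 * v ^ 2 * t) ?_, iteratedDeriv_one,
    key (fun t ↦ 2 * v ^ 2 * t + v * t * (v + v * t * (0 + v * t * 1)))
      (fun t ↦ 3 * v ^ 2 + 3 * v ^ 3 * t ^ 2) ?_]
  · simp
  · intro t
    have e : (fun t : ℝ ↦ 2 * (v : ℝ) ^ 2 * t + v * t * (v + v * t * (0 + v * t * 1))) =
        fun t ↦ 3 * (v : ℝ) ^ 2 * t + v ^ 3 * t ^ 3 := by ext; ring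
    rw [e]
    exact (((hasDerivAt_id t).const_mul (3 * (v : ℝ) ^ 2)).add
      ((hasDerivAt_pow 3 t).const_mul ((v : ℝ) ^ 3))).congr_deriv (by norm_num; ring)
  · intro t
    have e : (fun t : ℝ ↦ (v : ℝ) + v * t * (0 + v * t * 1)) = fun t ↦ (v : ℝ) + v ^ 2 * t ^ 2 := by
      ext; ring
    rw [e]
    exact (((hasDerivAt_pow 2 t).const_mul ((v : ℝ) ^ 2)).const_add (v : ℝ)).congr_deriv
      (by norm_num; ring)
  · intro t
    have e : (fun t : ℝ ↦ 0 + (v : ℝ) * t * 1) = fun t ↦ (v : ℝ) * t := by ext; ring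
    rw [e]
    exact ((hasDerivAt_id t).const_mul (v : ℝ)).congr_deriv (by ring)

open scoped NNReal in
lemma integral_sq_gaussianReal (v : ℝ≥0) : ∫ x, x ^ 2 ∂gaussianReal 0 v = v := by
  have h := variance_fun_id_gaussianReal (μ := 0) (v := v)
  rw [variance_eq_integral measurable_id'.aemeasurable] at h
  simpa using h

end Moments

/-! ### Mixed moments of diagonal Gaussian families -/

section GaussianCoordinates

variable {Ω ι : Type*} [MeasurableSpace Ω] [Fintype ι]

/-- All linear combinations of the family `X` are centred Gaussian, with the variances of the
linear combinations of independent variables of variances `d`. -/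
def IsDiagGaussian (π : Measure Ω) (X : ι → Ω → ℝ) (d : ι → ℝ) : Prop :=
  ∀ c : ι → ℝ, HasLaw (fun ω ↦ ∑ i, c i * X i ω) (gaussianReal 0 (∑ i, c i ^ 2 * d i).toNNReal) π

variable {π : Measure Ω} {X : ι → Ω → ℝ} {d : ι → ℝ}

lemma IsDiagGaussian.hasLaw (h : IsDiagGaussian π X d) (i : ι) :
    HasLaw (X i) (gaussianReal 0 (d i).toNNReal) π := by
  classical
  simpa [Pi.single_apply] using h (Pi.single i 1)

lemma IsDiagGaussian.hasLaw_add (h : IsDiagGaussian π X d) {i j : ι} (hij : i ≠ j) (s : ℝ) :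
    HasLaw (fun ω ↦ X i ω + s * X j ω) (gaussianReal 0 (d i + s ^ 2 * d j).toNNReal) π := by
  classical
  let e (l : ι) : ι → ℝ := Pi.single l 1
  have h2 : ∀ k, (e i k + s * e j k) ^ 2 = e i k + s ^ 2 * e j k := by
    intro k
    by_cases hi : k = i
    · subst hi; simp [e, hij]
    · by_cases hj : k = j
      · subst hj; simp [e, hij.symm]
      · simp [e, hi, hj]
  have h1 := h fun k ↦ e i k + s * e j k
  simp only [h2, add_mul, mul_assoc, Finset.sum_add_distrib, ← Finset.mul_sum] at h1
  simpa [e, Pi.single_apply] using h1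

lemma IsDiagGaussian.memLp (h : IsDiagGaussian π X d) (i : ι) : MemLp (X i) 4 π := by
  have h1 := memLp_id_gaussianReal' (μ := 0) (v := (d i).toNNReal) 4 (by simp)
  rw [← (h.hasLaw i).map_eq] at h1
  exact (memLp_map_measure_iff (by fun_prop) (h.hasLaw i).aemeasurable).1 h1

lemma IsDiagGaussian.integral_eq_zero (h : IsDiagGaussian π X d) (i : ι) :
    ∫ ω, X i ω ∂π = 0 := by
  rw [(h.hasLaw i).integral_eq, integral_id_gaussianReal]

lemma integral_sq_of_hasLaw {Z : Ω → ℝ} {v : ℝ} (hv : 0 ≤ v)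
    (h : HasLaw Z (gaussianReal 0 v.toNNReal) π) : ∫ ω, Z ω ^ 2 ∂π = v := by
  have := h.integral_comp (f := fun x : ℝ ↦ x ^ 2) (by fun_prop)
  rw [integral_sq_gaussianReal, Real.coe_toNNReal _ hv] at this
  exact this

lemma integral_pow_four_of_hasLaw {Z : Ω → ℝ} {v : ℝ} (hv : 0 ≤ v)
    (h : HasLaw Z (gaussianReal 0 v.toNNReal) π) : ∫ ω, Z ω ^ 4 ∂π = 3 * v ^ 2 := by
  have := h.integral_comp (f := fun x : ℝ ↦ x ^ 4) (by fun_prop)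
  rw [integral_pow_four_gaussianReal, Real.coe_toNNReal _ hv] at this
  exact this

lemma memLp_two_mul {f g : Ω → ℝ} (hf : MemLp f 4 π) (hg : MemLp g 4 π) :
    MemLp (fun ω ↦ f ω * g ω) 2 π := by
  have : ENNReal.HolderTriple 4 4 2 := by
    constructor
    rw [← two_mul, show (4 : ℝ≥0∞) = 2 * 2 by norm_num, ENNReal.mul_inv (by simp) (by simp),
      ← mul_assoc, ENNReal.mul_inv_cancel (by simp) (by simp), one_mul]
  exact hg.mul' hf

lemma integrable_mul {f g : Ω → ℝ} (hf : MemLp f 2 π) (hg : MemLp g 2 π) :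
    Integrable (fun ω ↦ f ω * g ω) π := hf.integrable_mul hg

/-- Off the diagonal, polarization: `X i + X j` has variance `d i + d j`, so the cross term
vanishes. -/
lemma IsDiagGaussian.integral_mul [IsProbabilityMeasure π] [DecidableEq ι]
    (h : IsDiagGaussian π X d) (hd : ∀ i, 0 ≤ d i)
    (i j : ι) : ∫ ω, X i ω * X j ω ∂π = if i = j then d i else 0 := by
  have m2 k : MemLp (X k) 2 π := (h.memLp k).mono_exponent (by norm_num)
  split_ifs with hij
  · subst hij
    simpa only [sq] using integral_sq_of_hasLaw (hd i) (h.hasLaw i)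
  · have h1 := integral_sq_of_hasLaw (add_nonneg (hd i) (mul_nonneg (sq_nonneg 1) (hd j)))
      (h.hasLaw_add hij 1)
    have hi := integral_sq_of_hasLaw (hd i) (h.hasLaw i)
    have hj := integral_sq_of_hasLaw (hd j) (h.hasLaw j)
    have e : ∀ ω, (X i ω + 1 * X j ω) ^ 2 = X i ω ^ 2 + X j ω ^ 2 + 2 * (X i ω * X j ω) := by
      intro ω; ring
    simp only [e] at h1
    rw [integral_add ((m2 i).integrable_sq.fun_add (m2 j).integrable_sq)
      ((integrable_mul (m2 i) (m2 j)).const_mul 2),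
      integral_add (m2 i).integrable_sq (m2 j).integrable_sq, integral_const_mul, hi, hj] at h1
    linarith

lemma IsDiagGaussian.integral_sq_mul_sq [IsProbabilityMeasure π] [DecidableEq ι]
    (h : IsDiagGaussian π X d) (hd : ∀ i, 0 ≤ d i)
    (i j : ι) : ∫ ω, X i ω ^ 2 * X j ω ^ 2 ∂π = d i * d j + if i = j then 2 * d i ^ 2 else 0 := by
  have m2 k l : MemLp (fun ω ↦ X k ω * X l ω) 2 π := memLp_two_mul (h.memLp k) (h.memLp l)
  split_ifs with hij
  · subst hij
    have := integral_pow_four_of_hasLaw (hd i) (h.hasLaw i)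
    simp only [← pow_add]
    rw [this]; ring
  · have h1 := integral_pow_four_of_hasLaw (add_nonneg (hd i) (mul_nonneg (sq_nonneg 1) (hd j)))
      (h.hasLaw_add hij 1)
    have h2 := integral_pow_four_of_hasLaw (add_nonneg (hd i) (mul_nonneg (sq_nonneg (-1)) (hd j)))
      (h.hasLaw_add hij (-1))
    have hi := integral_pow_four_of_hasLaw (hd i) (h.hasLaw i)
    have hj := integral_pow_four_of_hasLaw (hd j) (h.hasLaw j)
    have i4 : ∀ s, Integrable (fun ω ↦ (X i ω + s * X j ω) ^ 4) π := fun s ↦ by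
      have m := (h.memLp i).add ((h.memLp j).const_mul s)
      have := integrable_mul (memLp_two_mul m m) (memLp_two_mul m m)
      refine this.congr (ae_of_all _ fun ω ↦ ?_)
      simp; ring
    have e4 k : (fun ω ↦ X k ω ^ 4) = fun ω ↦ (X k ω * X k ω) * (X k ω * X k ω) := by
      ext; ring
    have j4 k : Integrable (fun ω ↦ X k ω ^ 4) π := by
      rw [e4]; exact integrable_mul (m2 k k) (m2 k k)
    -- Polarization of the quartic: fourth moments of `X i ± X j`, known from their laws, determine
    -- the mixed moment.
    have e : ∀ ω, X i ω ^ 2 * X j ω ^ 2 = (1 / 12) * (((X i ω + 1 * X j ω) ^ 4 +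
        (X i ω + (-1) * X j ω) ^ 4) - 2 * (X i ω ^ 4 + X j ω ^ 4)) := by
      intro ω; ring
    simp only [e]
    rw [integral_const_mul, integral_sub ((i4 1).fun_add (i4 (-1))) (((j4 i).fun_add (j4 j)).const_mul 2),
      integral_add (i4 1) (i4 (-1)), integral_const_mul, integral_add (j4 i) (j4 j), h1, h2, hi, hj]
    ring

end GaussianCoordinates

/-! ### Rearrangement inequality by linear programming duality -/

section Rearrangement

/-- Dual potentials for the product cost of two non-increasing non-negative sequences. -/
lemma exists_dual_potentials (N : ℕ) : ∀ a b : ℕ → ℝ, Antitone a → Antitone b → (∀ i, 0 ≤ a i) →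
    (∀ i, 0 ≤ b i) → ∃ u v : ℕ → ℝ, (∀ i, 0 ≤ u i) ∧ (∀ i, 0 ≤ v i) ∧
      (∀ i < N, ∀ j < N, a i * b j ≤ u i + v j) ∧ (∀ i < N, u i + v i = a i * b i) := by
  intro a b ha hb ha0 hb0
  -- Discrete forms of `∫ b da` and `∫ a db`. Taking `b (k + 1)` in one and `a k` in the other makes
  -- the summands of `u + v` telescope to `a i * b i`; monotonicity gives the off-diagonal
  -- inequality.
  let u : ℕ → ℝ := fun i ↦ ∑ k ∈ Finset.Ico i N, b (k + 1) * (a k - a (k + 1))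
  let v : ℕ → ℝ := fun j ↦ a N * b N + ∑ k ∈ Finset.Ico j N, a k * (b k - b (k + 1))
  have sub (f : ℕ → ℝ) (hf : Antitone f) (k : ℕ) : 0 ≤ f k - f (k + 1) :=
    sub_nonneg.2 (hf k.le_succ)
  have diag : ∀ i, i ≤ N → u i + v i = a i * b i := by
    intro i hi
    have : u i + v i = a N * b N + ∑ k ∈ Finset.Ico i N, (a k * b k - a (k + 1) * b (k + 1)) := by
      simp only [u, v]
      rw [add_left_comm, ← Finset.sum_add_distrib]
      congr 1
      exact Finset.sum_congr rfl fun k _ ↦ by ring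
    rw [this]
    have := Finset.sum_Ico_sub (fun k ↦ a k * b k) hi
    rw [← neg_inj, ← Finset.sum_neg_distrib] at this
    simp only [neg_sub] at this
    rw [this]; ring
  refine ⟨u, v, fun i ↦ Finset.sum_nonneg fun k _ ↦ mul_nonneg (hb0 _) (sub a ha k),
    fun i ↦ add_nonneg (mul_nonneg (ha0 _) (hb0 _))
      (Finset.sum_nonneg fun k _ ↦ mul_nonneg (ha0 _) (sub b hb k)), ?_, fun i hi ↦ diag i hi.le⟩
  intro i hi j hj
  rcases le_total i j with hij | hij
  · have h1 : u i = ∑ k ∈ Finset.Ico i j, b (k + 1) * (a k - a (k + 1)) + u j :=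
      (Finset.sum_Ico_consecutive _ hij hj.le).symm
    have h2 : (a i - a j) * b j ≤ ∑ k ∈ Finset.Ico i j, b (k + 1) * (a k - a (k + 1)) := by
      have := Finset.sum_Ico_sub a hij
      rw [← neg_sub (a j), ← this, ← Finset.sum_neg_distrib, Finset.sum_mul]
      refine Finset.sum_le_sum fun k hk ↦ ?_
      rw [neg_sub, mul_comm]
      exact mul_le_mul_of_nonneg_right (hb (Finset.mem_Ico.1 hk).2) (sub a ha k)
    have := diag j hj.le
    linarith
  · have h1 : v j = ∑ k ∈ Finset.Ico j i, a k * (b k - b (k + 1)) + v i := by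
      simp only [v]
      rw [← Finset.sum_Ico_consecutive _ hij hi.le]; ring
    have h2 : a i * (b j - b i) ≤ ∑ k ∈ Finset.Ico j i, a k * (b k - b (k + 1)) := by
      have := Finset.sum_Ico_sub b hij
      rw [← neg_sub (b i), ← this, ← Finset.sum_neg_distrib, Finset.mul_sum]
      refine Finset.sum_le_sum fun k hk ↦ ?_
      rw [neg_sub]
      exact mul_le_mul_of_nonneg_right (ha (Finset.mem_Ico.1 hk).2.le) (sub b hb k)
    have := diag i hi.le
    linarith

/-- Extension by zero of a finite sequence. -/
def extendZero {k : ℕ} (a : Fin k → ℝ) (i : ℕ) : ℝ := if h : i < k then a ⟨i, h⟩ else 0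

lemma extendZero_nonneg {k : ℕ} {a : Fin k → ℝ} (ha : ∀ i, 0 ≤ a i) (i : ℕ) :
    0 ≤ extendZero a i := by
  unfold extendZero; split_ifs <;> simp [ha]

lemma extendZero_coe {k : ℕ} (a : Fin k → ℝ) (i : Fin k) : extendZero a i = a i := by
  simp [extendZero]

lemma antitone_extendZero {k : ℕ} {a : Fin k → ℝ} (ha : ∀ i, 0 ≤ a i) (h : Antitone a) :
    Antitone (extendZero a) := by
  intro i j hij
  by_cases hj : j < k
  · rw [extendZero, extendZero, dif_pos hj, dif_pos (hij.trans_lt hj)]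
    exact h hij
  · rw [extendZero, dif_neg hj]
    exact extendZero_nonneg ha i

/-- A rearrangement inequality for doubly substochastic weights. -/
lemma sum_mul_le_of_substochastic {m n : ℕ} (hnm : n ≤ m) {a : Fin m → ℝ} {b : Fin n → ℝ}
    (ha : Antitone a) (hb : Antitone b) (ha0 : ∀ i, 0 ≤ a i) (hb0 : ∀ j, 0 ≤ b j)
    {w : Fin m → Fin n → ℝ} (hw : ∀ i j, 0 ≤ w i j) (hrow : ∀ i, ∑ j, w i j ≤ 1)
    (hcol : ∀ j, ∑ i, w i j ≤ 1) :
    ∑ i, ∑ j, w i j * (a i * b j) ≤ ∑ j, a (Fin.castLE hnm j) * b j := by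
  obtain ⟨u, v, hu, hv, huv, hd⟩ := exists_dual_potentials m (extendZero a) (extendZero b)
    (antitone_extendZero ha0 ha) (antitone_extendZero hb0 hb) (extendZero_nonneg ha0)
    (extendZero_nonneg hb0)
  -- Beyond `n` the padded `b` is zero, so two nonnegative potentials sum to zero. Their
  -- nonnegativity is also what lets row and column sums below `1` suffice.
  have hlast : ∀ i : ℕ, n ≤ i → i < m → u i = 0 ∧ v i = 0 := by
    intro i hi him
    have := hd i him
    rw [extendZero, extendZero, dif_neg hi.not_gt, mul_zero] at this
    have := hu i
    have := hv i
    constructor <;> linarith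
  calc ∑ i, ∑ j, w i j * (a i * b j) ≤ ∑ i : Fin m, ∑ j : Fin n, w i j * (u i + v j) := by
        refine Finset.sum_le_sum fun i _ ↦ Finset.sum_le_sum fun j _ ↦
          mul_le_mul_of_nonneg_left ?_ (hw i j)
        have := huv i i.2 j (j.2.trans_le hnm)
        rwa [extendZero_coe, extendZero_coe] at this
    _ = ∑ i : Fin m, (∑ j, w i j) * u i + ∑ j : Fin n, (∑ i, w i j) * v j := by
        simp only [mul_add, Finset.sum_add_distrib, Finset.sum_mul]
        congr 1
        exact Finset.sum_comm
    _ ≤ ∑ i : Fin m, u i + ∑ j : Fin n, v j :=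
        add_le_add (Finset.sum_le_sum fun i _ ↦ mul_le_of_le_one_left (hu _) (hrow i))
          (Finset.sum_le_sum fun j _ ↦ mul_le_of_le_one_left (hv _) (hcol j))
    _ = ∑ j : Fin n, (u j + v j) := by
        rw [Finset.sum_add_distrib, Fin.sum_univ_eq_sum_range, Fin.sum_univ_eq_sum_range u]
        congr 1
        refine (Finset.sum_subset (Finset.range_mono hnm) fun i hi hin ↦ ?_).symm
        exact (hlast i (by simpa using hin) (by simpa using hi)).1
    _ = ∑ j, a (Fin.castLE hnm j) * b j := by
        refine Finset.sum_congr rfl fun j _ ↦ ?_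
        rw [hd j (j.2.trans_le hnm), extendZero_coe,
          show (j : ℕ) = (Fin.castLE hnm j : Fin m) from rfl, extendZero_coe]

/-- The squared Frobenius norm of a cross-covariance matrix between two uncorrelated families
with sorted variances `a` and `b`, given the Bessel inequalities. -/
lemma sum_sq_le_of_bessel {m n : ℕ} (hnm : n ≤ m) {a : Fin m → ℝ} {b : Fin n → ℝ}
    (ha : Antitone a) (hb : Antitone b) (ha0 : ∀ i, 0 ≤ a i) (hb0 : ∀ j, 0 ≤ b j)
    {K : Fin m → Fin n → ℝ} (hrow : ∀ i, ∑ j, K i j ^ 2 / b j ≤ a i)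
    (hcol : ∀ j, ∑ i, K i j ^ 2 / a i ≤ b j) (hcs : ∀ i j, K i j ^ 2 ≤ a i * b j) :
    ∑ i, ∑ j, K i j ^ 2 ≤ ∑ j, a (Fin.castLE hnm j) * b j := by
  have hw := sum_mul_le_of_substochastic hnm ha hb ha0 hb0
    (w := fun i j ↦ K i j ^ 2 / (a i * b j))
    (fun i j ↦ div_nonneg (sq_nonneg _) (mul_nonneg (ha0 i) (hb0 j))) ?_ ?_
  · refine le_of_eq_of_le ?_ hw
    refine Finset.sum_congr rfl fun i _ ↦ Finset.sum_congr rfl fun j _ ↦ ?_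
    -- For zero variance the weight is `0` by the convention `x / 0 = 0`, and `hcs` forces `K i j =
    -- 0`.
    by_cases h : a i * b j = 0
    · have := hcs i j
      rw [h] at this ⊢
      rw [mul_zero]
      exact le_antisymm this (sq_nonneg _)
    · rw [div_mul_cancel₀ _ h]
  · intro i
    have e : ∀ j, K i j ^ 2 / (a i * b j) = K i j ^ 2 / b j / a i := fun j ↦ by
      rw [div_div, mul_comm]
    simp only [e, ← Finset.sum_div]
    exact div_le_one_of_le₀ (hrow i) (ha0 i)
  · intro j
    simp only [← div_div, ← Finset.sum_div]
    exact div_le_one_of_le₀ (hcol j) (hb0 j)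

end Rearrangement

/-! ### Expansion of the cost and Bessel's inequality -/

section Cost

variable {Ω ι : Type*} [Fintype ι]

/-- The signed quadratic form `∑ ε k z k ^ 2`. -/
def signedForm (ε : ι → ℝ) (Z : ι → Ω → ℝ) (ω : Ω) : ℝ := ∑ k, ε k * Z k ω ^ 2

variable {Z : ι → Ω → ℝ} {ε : ι → ℝ}

/-- Every term is a function of `ω` times a function of `ω'`, including the factors `1`, so that
Fubini applies term by term. -/
lemma sq_signed_sum_expand (ω ω' : Ω) :
    (∑ k, ε k * (Z k ω - Z k ω') ^ 2) ^ 2 =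
      signedForm ε Z ω ^ 2 * 1 + 1 * signedForm ε Z ω' ^ 2 +
      (2 * signedForm ε Z ω) * signedForm ε Z ω' -
      (∑ k, (4 * ε k * (signedForm ε Z ω * Z k ω)) * Z k ω' +
       ∑ k, (4 * ε k * Z k ω) * (signedForm ε Z ω' * Z k ω')) +
      ∑ k, ∑ l, (4 * (ε k * ε l) * (Z k ω * Z l ω)) * (Z k ω' * Z l ω') := by
  have h1 : ∑ k, ε k * (Z k ω - Z k ω') ^ 2 =
      signedForm ε Z ω + signedForm ε Z ω' - 2 * ∑ k, ε k * Z k ω * Z k ω' := by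
    simp only [signedForm, Finset.mul_sum, ← Finset.sum_add_distrib, ← Finset.sum_sub_distrib]
    exact Finset.sum_congr rfl fun k _ ↦ by ring
  have h2 : ∑ k, (4 * ε k * (signedForm ε Z ω * Z k ω)) * Z k ω' =
      4 * signedForm ε Z ω * ∑ k, ε k * Z k ω * Z k ω' := by
    rw [Finset.mul_sum]; exact Finset.sum_congr rfl fun k _ ↦ by ring
  have h3 : ∑ k, (4 * ε k * Z k ω) * (signedForm ε Z ω' * Z k ω') =
      4 * signedForm ε Z ω' * ∑ k, ε k * Z k ω * Z k ω' := by
    rw [Finset.mul_sum]; exact Finset.sum_congr rfl fun k _ ↦ by ring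
  have h4 : ∑ k, ∑ l, (4 * (ε k * ε l) * (Z k ω * Z l ω)) * (Z k ω' * Z l ω') =
      4 * (∑ k, ε k * Z k ω * Z k ω') ^ 2 := by
    rw [sq, Finset.sum_mul_sum, Finset.mul_sum]
    refine Finset.sum_congr rfl fun k _ ↦ ?_
    rw [Finset.mul_sum]
    exact Finset.sum_congr rfl fun l _ ↦ by ring
  rw [h1, h2, h3, h4]; ring

variable [MeasurableSpace Ω] {π : Measure Ω}

lemma memLp_signedForm (hZ : ∀ k l, MemLp (fun ω ↦ Z k ω * Z l ω) 2 π) :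
    MemLp (signedForm ε Z) 2 π := by
  unfold signedForm
  refine memLp_finsetSum _ fun k _ ↦ MemLp.const_mul ?_ _
  simpa only [sq] using hZ k k

/-- The cubic terms vanish because each carries a factor `Z k` of mean zero in one variable alone.
-/
lemma integrable_integral_sq_signed_sum [IsProbabilityMeasure π] (hZ1 : ∀ k, MemLp (Z k) 2 π)
    (hZ : ∀ k l, MemLp (fun ω ↦ Z k ω * Z l ω) 2 π) (h0 : ∀ k, ∫ ω, Z k ω ∂π = 0) :
    Integrable (fun p : Ω × Ω ↦ (∑ k, ε k * (Z k p.1 - Z k p.2) ^ 2) ^ 2) (π.prod π) ∧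
    ∫ p, (∑ k, ε k * (Z k p.1 - Z k p.2) ^ 2) ^ 2 ∂(π.prod π) =
      2 * ∫ ω, signedForm ε Z ω ^ 2 ∂π + 2 * (∫ ω, signedForm ε Z ω ∂π) ^ 2 +
      4 * ∑ k, ∑ l, ε k * ε l * (∫ ω, Z k ω * Z l ω ∂π) ^ 2 := by
  set U := signedForm ε Z with hU
  have mU : MemLp U 2 π := memLp_signedForm hZ
  have iU : Integrable U π := mU.integrable (by norm_num)
  have iU2 : Integrable (fun ω ↦ U ω ^ 2) π := mU.integrable_sq
  have iZ k : Integrable (Z k) π := (hZ1 k).integrable (by norm_num)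
  have iUZ k : Integrable (fun ω ↦ U ω * Z k ω) π := mU.integrable_mul (hZ1 k)
  have iZZ k l : Integrable (fun ω ↦ Z k ω * Z l ω) π := (hZ k l).integrable (by norm_num)
  have one : Integrable (fun _ : Ω ↦ (1 : ℝ)) π := integrable_const 1
  have t1 := iU2.mul_prod one
  have t2 := one.mul_prod iU2
  have t3 := (iU.const_mul 2).mul_prod iU
  have t4 k := ((iUZ k).const_mul (4 * ε k)).mul_prod (iZ k)
  have t5 k := ((iZ k).const_mul (4 * ε k)).mul_prod (iUZ k)
  have t6 k l := ((iZZ k l).const_mul (4 * (ε k * ε l))).mul_prod (iZZ k l)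
  have s4 := integrable_finsetSum Finset.univ fun k _ ↦ t4 k
  have s5 := integrable_finsetSum Finset.univ fun k _ ↦ t5 k
  have s6' k := integrable_finsetSum Finset.univ fun l _ ↦ t6 k l
  have s6 := integrable_finsetSum Finset.univ fun k _ ↦ s6' k
  simp only [sq_signed_sum_expand, ← hU]
  refine ⟨(((t1.fun_add t2).fun_add t3).sub' (s4.fun_add s5)).fun_add s6, ?_⟩
  rw [integral_add (((t1.fun_add t2).fun_add t3).sub' (s4.fun_add s5)) s6,
    integral_sub ((t1.fun_add t2).fun_add t3) (s4.fun_add s5), integral_add (t1.fun_add t2) t3, integral_add t1 t2,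
    integral_add s4 s5, integral_finsetSum _ fun k _ ↦ t4 k, integral_finsetSum _ fun k _ ↦ t5 k,
    integral_finsetSum _ fun k _ ↦ s6' k,
    Finset.sum_congr rfl fun k _ ↦ integral_finsetSum _ fun l _ ↦ t6 k l]
  rw [integral_prod_mul (fun ω ↦ U ω ^ 2) (fun _ ↦ 1),
    integral_prod_mul (fun _ ↦ 1) (fun ω ↦ U ω ^ 2), integral_prod_mul (fun ω ↦ 2 * U ω) U]
  have e4 k := integral_prod_mul (μ := π) (ν := π) (fun ω ↦ 4 * ε k * (U ω * Z k ω)) (Z k)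
  have e5 k := integral_prod_mul (μ := π) (ν := π) (fun ω ↦ 4 * ε k * Z k ω) (fun ω ↦ U ω * Z k ω)
  have e6 k l := integral_prod_mul (μ := π) (ν := π) (fun ω ↦ 4 * (ε k * ε l) * (Z k ω * Z l ω))
    (fun ω ↦ Z k ω * Z l ω)
  simp only [e4, e5, e6, integral_const_mul, h0]
  simp only [integral_const, probReal_univ, smul_eq_mul, mul_one, one_mul, mul_zero, zero_mul,
    Finset.sum_const_zero, Finset.mul_sum]
  have : ∀ k l, 4 * (ε k * ε l) * (∫ ω, Z k ω * Z l ω ∂π) * (∫ ω, Z k ω * Z l ω ∂π) =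
      4 * (ε k * ε l * (∫ ω, Z k ω * Z l ω ∂π) ^ 2) := fun k l ↦ by ring
  simp only [this]
  ring

/-- Bessel's inequality for an uncorrelated family of random variables. -/
lemma sum_sq_div_le [IsProbabilityMeasure π] [DecidableEq ι] {d : ι → ℝ} (hZ1 : ∀ k, MemLp (Z k) 2 π)
    (hZ : ∀ i j, ∫ ω, Z i ω * Z j ω ∂π = if i = j then d i else 0) {W : Ω → ℝ} (hW : MemLp W 2 π) :
    ∑ i, (∫ ω, Z i ω * W ω ∂π) ^ 2 / d i ≤ ∫ ω, W ω ^ 2 ∂π := by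
  set κ : ι → ℝ := fun i ↦ ∫ ω, Z i ω * W ω ∂π with hκ
  have iZW k : Integrable (fun ω ↦ Z k ω * W ω) π := (hZ1 k).integrable_mul hW
  have iZZ k l : Integrable (fun ω ↦ Z k ω * Z l ω) π := (hZ1 k).integrable_mul (hZ1 l)
  -- The residual of `W` after projection onto the family has nonnegative second moment.
  have h := integral_nonneg (μ := π) (f := fun ω ↦ (W ω - ∑ i, κ i / d i * Z i ω) ^ 2)
    fun ω ↦ sq_nonneg _
  have e : ∀ ω, (W ω - ∑ i, κ i / d i * Z i ω) ^ 2 = W ω ^ 2 -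
      ∑ i, 2 * (κ i / d i) * (Z i ω * W ω) +
      ∑ i, ∑ j, (κ i / d i * (κ j / d j)) * (Z i ω * Z j ω) := by
    intro ω
    rw [sub_sq, sq (∑ i, κ i / d i * Z i ω), Finset.sum_mul_sum, Finset.mul_sum]
    congr 1
    · congr 1
      exact Finset.sum_congr rfl fun i _ ↦ by ring
    · exact Finset.sum_congr rfl fun i _ ↦ Finset.sum_congr rfl fun j _ ↦ by ring
  simp only [e] at h
  have s1 := integrable_finsetSum Finset.univ fun k _ ↦ (iZW k).const_mul (2 * (κ k / d k))
  have s2' k := integrable_finsetSum Finset.univ fun l _ ↦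
    (iZZ k l).const_mul (κ k / d k * (κ l / d l))
  have s2 := integrable_finsetSum Finset.univ fun k _ ↦ s2' k
  rw [integral_add (hW.integrable_sq.sub' s1) s2, integral_sub hW.integrable_sq s1,
    integral_finsetSum _ fun k _ ↦ (iZW k).const_mul _, integral_finsetSum _ fun k _ ↦ s2' k,
    Finset.sum_congr rfl fun k _ ↦ integral_finsetSum _ fun l _ ↦ (iZZ k l).const_mul _] at h
  simp only [integral_const_mul, hZ, mul_ite, mul_zero, Finset.sum_ite_eq, Finset.mem_univ,
    if_true] at h
  have e1 : ∀ i, 2 * (κ i / d i) * ∫ ω, Z i ω * W ω ∂π = 2 * (κ i ^ 2 / d i) := fun i ↦ by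
    rw [show ∫ ω, Z i ω * W ω ∂π = κ i from rfl]; ring
  have e2 : ∀ i, κ i / d i * (κ i / d i) * d i = κ i ^ 2 / d i := fun i ↦ by
    -- Degenerate directions contribute zero on both sides, by `x / 0 = 0`.
    by_cases hd : d i = 0
    · simp [hd]
    · field_simp
  simp only [e1, e2, ← Finset.mul_sum] at h
  linarith

end Cost

/-! ### Eigenbasis coordinates of a multivariate Gaussian -/

section Coordinates

variable {k : ℕ}

/-- The coordinates of `x - c` in the orthonormal basis formed by the columns of `P`. -/
def coord (P : Matrix (Fin k) (Fin k) ℝ) (c : EuclideanSpace ℝ (Fin k)) (i : Fin k)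
    (x : EuclideanSpace ℝ (Fin k)) : ℝ := ∑ l, P l i * (x l - c l)

lemma norm_sub_sq_eq_sum_coord {P : Matrix (Fin k) (Fin k) ℝ}
    (hP : P ∈ Matrix.orthogonalGroup (Fin k) ℝ) (c x y : EuclideanSpace ℝ (Fin k)) :
    ‖x - y‖ ^ 2 = ∑ i, (coord P c i x - coord P c i y) ^ 2 := by
  have h1 : ∀ i, coord P c i x - coord P c i y = (P.transpose.mulVec (x - y).ofLp) i := by
    intro i
    simp only [coord, ← Finset.sum_sub_distrib, Matrix.mulVec, dotProduct, Matrix.transpose_apply]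
    exact Finset.sum_congr rfl fun l _ ↦ by simp; ring
  have h2 : ∑ i, (P.transpose.mulVec (x - y).ofLp) i ^ 2 =
      P.transpose.mulVec (x - y).ofLp ⬝ᵥ P.transpose.mulVec (x - y).ofLp := by
    simp [dotProduct, sq]
  have h3 : P * P.transpose = 1 := (Matrix.mem_orthogonalGroup_iff (Fin k) ℝ).1 hP
  simp only [h1]
  rw [h2, Matrix.dotProduct_mulVec, Matrix.vecMul_transpose, Matrix.mulVec_mulVec, h3,
    Matrix.one_mulVec, EuclideanSpace.real_norm_sq_eq]
  simp [dotProduct, sq]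

variable {S P D : Matrix (Fin k) (Fin k) ℝ}

lemma IsSortedDiagonalization.eq_diagonal (h : IsSortedDiagonalization S P D) :
    D = Matrix.diagonal D.diag := h.isDiag.diagonal_diag.symm

lemma IsSortedDiagonalization.quadratic_form (h : IsSortedDiagonalization S P D) (c : Fin k → ℝ) :
    P.mulVec c ⬝ᵥ S.mulVec (P.mulVec c) = ∑ i, c i ^ 2 * D.diag i := by
  have h3 : P.transpose * P = 1 := (Matrix.mem_orthogonalGroup_iff' (Fin k) ℝ).1 h.orthogonal
  have h4 : P.transpose * (S * P) = D := by
    rw [h.eq_mul, Matrix.mul_assoc, h3, Matrix.mul_one, ← Matrix.mul_assoc, h3, Matrix.one_mul]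
  rw [Matrix.mulVec_mulVec, ← Matrix.vecMul_transpose P, ← Matrix.dotProduct_mulVec,
    Matrix.mulVec_mulVec, h4, h.eq_diagonal]
  simp only [dotProduct, Matrix.mulVec_diagonal, Matrix.diag_diagonal]
  exact Finset.sum_congr rfl fun i _ ↦ by ring

lemma IsSortedDiagonalization.diag_nonneg (h : IsSortedDiagonalization S P D)
    (hS : S.PosSemidef) (i : Fin k) : 0 ≤ D.diag i := by
  have h1 := h.quadratic_form (Pi.single i 1)
  have h2 := hS.dotProduct_mulVec_nonneg (P.mulVec (Pi.single i 1))
  rw [star_trivial, h1] at h2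
  simpa [Pi.single_apply] using h2

lemma hasLaw_inner_multivariateGaussian (hS : S.PosSemidef) (c t : EuclideanSpace ℝ (Fin k)) :
    HasLaw (fun x ↦ inner ℝ t (x - c)) (gaussianReal 0 (t.ofLp ⬝ᵥ S.mulVec t.ofLp).toNNReal)
      (multivariateGaussian c S) := by
  have h1 : HasLaw (fun x ↦ innerSL ℝ t x)
      (gaussianReal (inner ℝ t c) (t.ofLp ⬝ᵥ S.mulVec t.ofLp).toNNReal)
      (multivariateGaussian c S) := by
    refine ⟨by fun_prop, ?_⟩
    rw [IsGaussian.map_eq_gaussianReal, ContinuousLinearMap.integral_comp_id_comm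
      IsGaussian.integrable_id, integral_id_multivariateGaussian]
    congr 2
    rw [← covarianceBilin_multivariateGaussian (μ := c) hS, covarianceBilin_self
      IsGaussian.memLp_two_id]
    rfl
  have h2 := gaussianReal_sub_const h1 (inner ℝ t c)
  simpa [inner_sub_right] using h2

/-- A combination of coordinates with coefficients `u` is the inner product of `P u` with `x - c`,
whose variance is diagonalized by `Pᵀ S P = D`. -/
lemma isDiagGaussian_coord (hS : S.PosSemidef) (h : IsSortedDiagonalization S P D)
    (c : EuclideanSpace ℝ (Fin k)) :
    IsDiagGaussian (multivariateGaussian c S) (coord P c) D.diag := by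
  intro u
  have h1 := hasLaw_inner_multivariateGaussian hS c (WithLp.toLp 2 (P.mulVec u))
  simp only [h.quadratic_form] at h1
  convert h1 using 2 with x
  simp only [coord, PiLp.inner_apply, Matrix.mulVec, dotProduct, Finset.mul_sum]
  rw [Finset.sum_comm]
  refine Finset.sum_congr rfl fun l _ ↦ ?_
  simp only [PiLp.sub_apply, RCLike.inner_apply, conj_trivial, Finset.mul_sum]
  exact Finset.sum_congr rfl fun i _ ↦ by ring

end Coordinates

/-! ### Bounds on the coupling-dependent moments -/

section Moments

variable {Ω ι : Type*} [MeasurableSpace Ω] [Fintype ι] {π : Measure Ω}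

lemma IsDiagGaussian.comp {Ω' : Type*} [MeasurableSpace Ω'] {μ : Measure Ω'} {X : ι → Ω' → ℝ}
    {d : ι → ℝ} (h : IsDiagGaussian μ X d) {f : Ω → Ω'} (hf : HasLaw f μ π) :
    IsDiagGaussian π (fun i ω ↦ X i (f ω)) d :=
  fun c ↦ (h c).comp hf

/-- The quadratic `t ↦ ∫ (f + t g)²` is nonnegative, so its discriminant is at most zero. -/
lemma sq_integral_mul_le {f g : Ω → ℝ} (hf : MemLp f 2 π) (hg : MemLp g 2 π) :
    (∫ ω, f ω * g ω ∂π) ^ 2 ≤ (∫ ω, f ω ^ 2 ∂π) * ∫ ω, g ω ^ 2 ∂π := by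
  have h : ∀ t : ℝ, 0 ≤ (∫ ω, g ω ^ 2 ∂π) * (t * t) + (2 * ∫ ω, f ω * g ω ∂π) * t +
      ∫ ω, f ω ^ 2 ∂π := by
    intro t
    have h1 := integral_nonneg (μ := π) (f := fun ω ↦ (f ω + t * g ω) ^ 2) fun ω ↦ sq_nonneg _
    have e : ∀ ω, (f ω + t * g ω) ^ 2 = f ω ^ 2 + 2 * t * (f ω * g ω) + t ^ 2 * g ω ^ 2 :=
      fun ω ↦ by ring
    simp only [e] at h1
    rw [integral_add (hf.integrable_sq.fun_add ((integrable_mul hf hg).const_mul _))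
      (hg.integrable_sq.const_mul _), integral_add hf.integrable_sq
      ((integrable_mul hf hg).const_mul _), integral_const_mul, integral_const_mul] at h1
    linarith
  have := discrim_le_zero h
  rw [discrim] at this
  linarith

variable {X : ι → Ω → ℝ} {d : ι → ℝ}

lemma IsDiagGaussian.memLp_sum_sq (h : IsDiagGaussian π X d) :
    MemLp (fun ω ↦ ∑ i, X i ω ^ 2) 2 π :=
  memLp_finsetSum _ fun i _ ↦ by
    simpa only [sq] using memLp_two_mul (h.memLp i) (h.memLp i)

variable [IsProbabilityMeasure π]

lemma IsDiagGaussian.memLp_two (h : IsDiagGaussian π X d) (i : ι) : MemLp (X i) 2 π :=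
  (h.memLp i).mono_exponent (by norm_num)

lemma IsDiagGaussian.integral_sum_sq (h : IsDiagGaussian π X d) (hd : ∀ i, 0 ≤ d i) :
    ∫ ω, ∑ i, X i ω ^ 2 ∂π = ∑ i, d i := by
  rw [integral_finsetSum _ fun i _ ↦ (h.memLp_two i).integrable_sq]
  exact Finset.sum_congr rfl fun i _ ↦ integral_sq_of_hasLaw (hd i) (h.hasLaw i)

lemma IsDiagGaussian.integral_sq_sum_sq (h : IsDiagGaussian π X d) (hd : ∀ i, 0 ≤ d i) :
    ∫ ω, (∑ i, X i ω ^ 2) ^ 2 ∂π = (∑ i, d i) ^ 2 + 2 * ∑ i, d i ^ 2 := by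
  classical
  have hi i j : Integrable (fun ω ↦ X i ω ^ 2 * X j ω ^ 2) π := by
    have m k := memLp_two_mul (h.memLp k) (h.memLp k)
    simpa only [sq] using integrable_mul (m i) (m j)
  simp only [sq (∑ i, X i _ ^ 2), Finset.sum_mul_sum]
  rw [integral_finsetSum _ fun i _ ↦ integrable_finsetSum _ fun j _ ↦ hi i j,
    Finset.sum_congr rfl fun i _ ↦ integral_finsetSum _ fun j _ ↦ hi i j]
  simp only [h.integral_sq_mul_sq hd, Finset.sum_add_distrib, Finset.sum_ite_eq, Finset.mem_univ,
    if_true, ← Finset.mul_sum]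
  rw [sq (∑ i, d i), Finset.sum_mul_sum]
  simp only [Finset.mul_sum]

/-- Cauchy–Schwarz for the centred squared norms, whose variances are `2 x ^ 2` and `2 y ^ 2`.
Nothing is assumed on the joint law of `X` and `Y`. -/
lemma integral_mul_sum_sq_le {κ : Type*} [Fintype κ] {Y : κ → Ω → ℝ} {e : κ → ℝ}
    (hX : IsDiagGaussian π X d) (hY : IsDiagGaussian π Y e) (hd : ∀ i, 0 ≤ d i)
    (he : ∀ j, 0 ≤ e j) {x y : ℝ} (hx : 0 ≤ x) (hy : 0 ≤ y) (hx2 : x ^ 2 = ∑ i, d i ^ 2)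
    (hy2 : y ^ 2 = ∑ j, e j ^ 2) :
    ∫ ω, (∑ i, X i ω ^ 2) * (∑ j, Y j ω ^ 2) ∂π ≤ (∑ i, d i) * (∑ j, e j) + 2 * (x * y) := by
  set A := fun ω ↦ ∑ i, X i ω ^ 2 with hA
  set B := fun ω ↦ ∑ j, Y j ω ^ 2 with hB
  have mA : MemLp A 2 π := hX.memLp_sum_sq
  have mB : MemLp B 2 π := hY.memLp_sum_sq
  have eA : ∫ ω, A ω ∂π = ∑ i, d i := hX.integral_sum_sq hd
  have eB : ∫ ω, B ω ∂π = ∑ i, e i := hY.integral_sum_sq he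
  have vA : ∫ ω, A ω ^ 2 ∂π = (∑ i, d i) ^ 2 + 2 * x ^ 2 := hx2 ▸ hX.integral_sq_sum_sq hd
  have vB : ∫ ω, B ω ^ 2 ∂π = (∑ i, e i) ^ 2 + 2 * y ^ 2 := hy2 ▸ hY.integral_sq_sum_sq he
  have var (f : Ω → ℝ) (hf : MemLp f 2 π) (s : ℝ) (hs : ∫ ω, f ω ∂π = s) :
      ∫ ω, (f ω - s) ^ 2 ∂π = ∫ ω, f ω ^ 2 ∂π - s ^ 2 := by
    have := variance_eq_sub hf
    rw [variance_eq_integral hf.aestronglyMeasurable.aemeasurable, hs] at this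
    simpa using this
  have cs := sq_integral_mul_le (mA.sub (memLp_const (∑ i, d i))) (mB.sub (memLp_const (∑ i, e i)))
  simp only [Pi.sub_apply] at cs
  rw [var A mA _ eA, var B mB _ eB, vA, vB] at cs
  have cov : ∫ ω, (A ω - ∑ i, d i) * (B ω - ∑ i, e i) ∂π =
      ∫ ω, A ω * B ω ∂π - (∑ i, d i) * ∑ i, e i := by
    have e1 : ∀ ω, (A ω - ∑ i, d i) * (B ω - ∑ i, e i) = A ω * B ω -
        ((∑ i, d i) * B ω + (∑ i, e i) * A ω) + (∑ i, d i) * ∑ i, e i := fun ω ↦ by ring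
    have iA : Integrable A π := mA.integrable (by norm_num)
    have iB : Integrable B π := mB.integrable (by norm_num)
    have iL := (iB.const_mul (∑ i, d i)).fun_add (iA.const_mul (∑ i, e i))
    simp only [e1]
    rw [integral_add ((integrable_mul mA mB).sub' iL) (integrable_const _),
      integral_sub (integrable_mul mA mB) iL, integral_add (iB.const_mul _) (iA.const_mul _),
      integral_const_mul, integral_const_mul, eA, eB]
    simp
    ring
  rw [cov] at cs
  have : ∫ ω, A ω * B ω ∂π - (∑ i, d i) * ∑ i, e i ≤ 2 * (x * y) :=
    (abs_le_of_sq_le_sq' (cs.trans_eq (by ring)) (by positivity)).2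
  linarith

/-- The cross-covariance bound for two diagonal Gaussian families with sorted variances. -/
lemma sum_sq_crossCov_le {m n : ℕ} (hnm : n ≤ m) {X : Fin m → Ω → ℝ} {Y : Fin n → Ω → ℝ}
    {a : Fin m → ℝ} {b : Fin n → ℝ} (hX : IsDiagGaussian π X a) (hY : IsDiagGaussian π Y b)
    (ha : Antitone a) (hb : Antitone b) (ha0 : ∀ i, 0 ≤ a i) (hb0 : ∀ j, 0 ≤ b j) :
    ∑ i, ∑ j, (∫ ω, X i ω * Y j ω ∂π) ^ 2 ≤ ∑ j, a (Fin.castLE hnm j) * b j := by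
  have vX i : ∫ ω, X i ω ^ 2 ∂π = a i := integral_sq_of_hasLaw (ha0 i) (hX.hasLaw i)
  have vY j : ∫ ω, Y j ω ^ 2 ∂π = b j := integral_sq_of_hasLaw (hb0 j) (hY.hasLaw j)
  refine sum_sq_le_of_bessel hnm ha hb ha0 hb0 (fun i ↦ ?_) (fun j ↦ ?_) fun i j ↦ ?_
  · have := sum_sq_div_le hY.memLp_two (hY.integral_mul hb0) (hX.memLp_two i)
    simpa only [vX, mul_comm] using this
  · have := sum_sq_div_le hX.memLp_two (hX.integral_mul ha0) (hY.memLp_two j)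
    simpa only [vY] using this
  · have := sq_integral_mul_le (hX.memLp_two i) (hY.memLp_two j)
    rwa [vX, vY] at this

end Moments

/-! ### Frobenius norms and the lower bound -/

section Frobenius

open scoped Matrix.Norms.Frobenius

lemma frobenius_norm_sq_of_isDiag {k : ℕ} {D : Matrix (Fin k) (Fin k) ℝ} (h : D.IsDiag) :
    ‖D‖ ^ 2 = ∑ i, D.diag i ^ 2 := by
  rw [Matrix.frobenius_norm_def, ← Real.sqrt_eq_rpow, Real.sq_sqrt (by positivity)]
  refine Finset.sum_congr rfl fun i _ ↦ ?_
  rw [Finset.sum_eq_single i]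
  · simp
  · intro j _ hj
    simp [h hj.symm]
  · simp

/-- The squared norm of the leading block cancels, leaving the form that the two moment bounds
produce. -/
lemma LGWSq_eq {m n : ℕ} (hnm : n ≤ m) {D₀ : Matrix (Fin m) (Fin m) ℝ}
    {D₁ : Matrix (Fin n) (Fin n) ℝ} (h₀ : D₀.IsDiag) (h₁ : D₁.IsDiag) :
    LGWSq hnm D₀ D₁ = 4 * (∑ i, D₀.diag i - ∑ j, D₁.diag j) ^ 2 + 8 * ‖D₀‖ ^ 2 + 8 * ‖D₁‖ ^ 2 -
      8 * (‖D₀‖ * ‖D₁‖) - 8 * ∑ j, D₀.diag (Fin.castLE hnm j) * D₁.diag j := by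
  have hL : (leadingBlock hnm D₀).IsDiag := h₀.submatrix (Fin.castLE_injective hnm)
  have e : ∀ j, (leadingBlock hnm D₀).diag j = D₀.diag (Fin.castLE hnm j) := fun _ ↦ rfl
  have e1 : ‖leadingBlock hnm D₀ - D₁‖ ^ 2 = ‖leadingBlock hnm D₀‖ ^ 2 + ‖D₁‖ ^ 2 -
      2 * ∑ j, D₀.diag (Fin.castLE hnm j) * D₁.diag j := by
    rw [frobenius_norm_sq_of_isDiag (hL.sub h₁), frobenius_norm_sq_of_isDiag hL,
      frobenius_norm_sq_of_isDiag h₁, Finset.mul_sum, ← Finset.sum_add_distrib,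
      ← Finset.sum_sub_distrib]
    refine Finset.sum_congr rfl fun j _ ↦ ?_
    rw [Matrix.diag_sub, Pi.sub_apply, e]
    ring
  rw [LGWSq, e1]
  simp only [Matrix.trace]
  ring

end Frobenius

/-! ### Cost of a coupling -/

section Coupling

variable {m n : ℕ} {π : Measure (EuclideanSpace ℝ (Fin m) × EuclideanSpace ℝ (Fin n))}

/-- The cost of a plan is finite, and given by second and fourth moments, when the coordinates of
both components are diagonal Gaussian families. -/
lemma gwCost_eq [IsProbabilityMeasure π]
    {P₀ : Matrix (Fin m) (Fin m) ℝ} {P₁ : Matrix (Fin n) (Fin n) ℝ}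
    (hP₀ : P₀ ∈ Matrix.orthogonalGroup (Fin m) ℝ) (hP₁ : P₁ ∈ Matrix.orthogonalGroup (Fin n) ℝ)
    {m₀ : EuclideanSpace ℝ (Fin m)} {m₁ : EuclideanSpace ℝ (Fin n)} {a : Fin m → ℝ} {b : Fin n → ℝ}
    (hX : IsDiagGaussian π (fun i p ↦ coord P₀ m₀ i p.1) a)
    (hY : IsDiagGaussian π (fun j p ↦ coord P₁ m₁ j p.2) b)
    (ha0 : ∀ i, 0 ≤ a i) (hb0 : ∀ j, 0 ≤ b j) :
    gwCost π = ENNReal.ofReal (4 * (∑ i, a i) ^ 2 + 4 * (∑ j, b j) ^ 2 -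
      4 * (∑ i, a i) * (∑ j, b j) + 8 * ∑ i, a i ^ 2 + 8 * ∑ j, b j ^ 2 -
      4 * ∫ p, (∑ i, coord P₀ m₀ i p.1 ^ 2) * (∑ j, coord P₁ m₁ j p.2 ^ 2) ∂π -
      8 * ∑ i, ∑ j, (∫ p, coord P₀ m₀ i p.1 * coord P₁ m₁ j p.2 ∂π) ^ 2) := by
  set X : Fin m → EuclideanSpace ℝ (Fin m) × EuclideanSpace ℝ (Fin n) → ℝ :=
    fun i p ↦ coord P₀ m₀ i p.1 with hXdef
  set Y : Fin n → EuclideanSpace ℝ (Fin m) × EuclideanSpace ℝ (Fin n) → ℝ :=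
    fun j p ↦ coord P₁ m₁ j p.2 with hYdef
  let Z : Fin m ⊕ Fin n → EuclideanSpace ℝ (Fin m) × EuclideanSpace ℝ (Fin n) → ℝ := Sum.elim X Y
  -- Signs `+1` on `X` and `-1` on `Y` turn the difference of squared distances into a single signed
  -- form.
  let ε : Fin m ⊕ Fin n → ℝ := Sum.elim (fun _ ↦ 1) (fun _ ↦ -1)
  have hcost : ∀ p q : EuclideanSpace ℝ (Fin m) × EuclideanSpace ℝ (Fin n),
      ‖p.1 - q.1‖ ^ 2 - ‖p.2 - q.2‖ ^ 2 = ∑ k, ε k * (Z k p - Z k q) ^ 2 := by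
    intro p q
    rw [norm_sub_sq_eq_sum_coord hP₀ m₀, norm_sub_sq_eq_sum_coord hP₁ m₁, Fintype.sum_sum_type]
    simp [Z, ε, X, Y, sub_eq_add_neg]
  have mZ : ∀ k, MemLp (Z k) 4 π := by
    rintro (i | j)
    exacts [hX.memLp i, hY.memLp j]
  have zZ : ∀ k, ∫ ω, Z k ω ∂π = 0 := by
    rintro (i | j)
    exacts [hX.integral_eq_zero i, hY.integral_eq_zero j]
  obtain ⟨hint, hval⟩ := integrable_integral_sq_signed_sum (ε := ε)
    (fun k ↦ (mZ k).mono_exponent (by norm_num)) (fun k l ↦ memLp_two_mul (mZ k) (mZ l)) zZ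
  have hU : ∀ p, signedForm ε Z p = ∑ i, X i p ^ 2 - ∑ j, Y j p ^ 2 := by
    intro p
    simp [signedForm, Z, ε, sub_eq_add_neg]
  have mA : MemLp (fun p ↦ ∑ i, X i p ^ 2) 2 π := hX.memLp_sum_sq
  have mB : MemLp (fun p ↦ ∑ j, Y j p ^ 2) 2 π := hY.memLp_sum_sq
  have hU1 : ∫ p, signedForm ε Z p ∂π = ∑ i, a i - ∑ j, b j := by
    simp only [hU]
    rw [integral_sub (mA.integrable (by norm_num)) (mB.integrable (by norm_num)),
      hX.integral_sum_sq ha0, hY.integral_sum_sq hb0]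
  have hU2 : ∫ p, signedForm ε Z p ^ 2 ∂π = (∑ i, a i) ^ 2 + 2 * ∑ i, a i ^ 2 -
      2 * ∫ p, (∑ i, X i p ^ 2) * (∑ j, Y j p ^ 2) ∂π +
      ((∑ j, b j) ^ 2 + 2 * ∑ j, b j ^ 2) := by
    simp only [hU, sub_sq, mul_assoc]
    rw [integral_add (mA.integrable_sq.sub' ((integrable_mul mA mB).const_mul 2)) mB.integrable_sq,
      integral_sub mA.integrable_sq ((integrable_mul mA mB).const_mul 2), integral_const_mul,
      hX.integral_sq_sum_sq ha0, hY.integral_sq_sum_sq hb0]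
  have hK : ∑ k, ∑ l, ε k * ε l * (∫ ω, Z k ω * Z l ω ∂π) ^ 2 = ∑ i, a i ^ 2 + ∑ j, b j ^ 2 -
      2 * ∑ i, ∑ j, (∫ p, X i p * Y j p ∂π) ^ 2 := by
    have hc : ∀ i j, ∫ p, Y j p * X i p ∂π = ∫ p, X i p * Y j p ∂π := fun i j ↦ by
      simp only [mul_comm]
    simp only [Fintype.sum_sum_type, Z, ε, Sum.elim_inl, Sum.elim_inr, hX.integral_mul ha0,
      hY.integral_mul hb0, hc]
    simp only [ite_pow, ne_eq, OfNat.ofNat_ne_zero, not_false_eq_true, zero_pow, mul_one, one_mul,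
      mul_neg, neg_neg, neg_mul, Finset.sum_neg_distrib, Finset.sum_add_distrib, Finset.sum_ite_eq,
      Finset.mem_univ, if_true]
    rw [Finset.sum_comm (f := fun j i ↦ (∫ p, X i p * Y j p ∂π) ^ 2)]
    ring
  rw [hU1, hU2, hK] at hval
  have hfin : gwCost π = ENNReal.ofReal (∫ p, (∑ k, ε k * (Z k p.1 - Z k p.2) ^ 2) ^ 2 ∂π.prod π) := by
    rw [ofReal_integral_eq_lintegral_ofReal hint (ae_of_all _ fun p ↦ sq_nonneg _),
      lintegral_prod _ hint.aestronglyMeasurable.aemeasurable.ennreal_ofReal, gwCost]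
    simp only [hcost]
  rw [hfin, hval]
  congr 1
  ring

end Coupling

end GromovGauss

theorem mainTheorem3 {m n : ℕ} (hnm : n ≤ m)
    (m₀ : EuclideanSpace ℝ (Fin m)) (S₀ : Matrix (Fin m) (Fin m) ℝ) (hS₀ : S₀.PosSemidef)
    (hS₀_nonsing : IsUnit S₀.det)
    (m₁ : EuclideanSpace ℝ (Fin n)) (S₁ : Matrix (Fin n) (Fin n) ℝ) (hS₁ : S₁.PosSemidef)
    (P₀ D₀ : Matrix (Fin m) (Fin m) ℝ) (hD₀ : GromovGauss.IsSortedDiagonalization S₀ P₀ D₀)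
    (P₁ D₁ : Matrix (Fin n) (Fin n) ℝ) (hD₁ : GromovGauss.IsSortedDiagonalization S₁ P₁ D₁)
    (μ : Measure (EuclideanSpace ℝ (Fin m))) (hμ : μ = multivariateGaussian m₀ S₀)
    (ν : Measure (EuclideanSpace ℝ (Fin n))) (hν : ν = multivariateGaussian m₁ S₁) :
    ENNReal.ofReal (GromovGauss.LGWSq hnm D₀ D₁) ≤ GromovGauss.GWSq μ ν ∧
      GromovGauss.GWSq μ ν ≤ GromovGauss.GGWSq μ ν ∧
      GromovGauss.GGWSq μ ν < ⊤ := by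
  open GromovGauss in
  open scoped Matrix.Norms.Frobenius in
  subst hμ hν
  have ha0 := hD₀.diag_nonneg hS₀
  have hb0 := hD₁.diag_nonneg hS₁
  -- Being a diagonal Gaussian family involves one marginal only, so this holds for every coupling,
  -- Gaussian or not.
  have key : ∀ π ∈ couplings (multivariateGaussian m₀ S₀) (multivariateGaussian m₁ S₁),
      IsProbabilityMeasure π ∧ IsDiagGaussian π (fun i p ↦ coord P₀ m₀ i p.1) D₀.diag ∧
      IsDiagGaussian π (fun j p ↦ coord P₁ m₁ j p.2) D₁.diag := by
    rintro π ⟨h0, h1⟩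
    have l0 : HasLaw Prod.fst (multivariateGaussian m₀ S₀) π := ⟨by fun_prop, h0⟩
    have l1 : HasLaw Prod.snd (multivariateGaussian m₁ S₁) π := ⟨by fun_prop, h1⟩
    exact ⟨l0.isProbabilityMeasure, (isDiagGaussian_coord hS₀ hD₀ m₀).comp l0,
      (isDiagGaussian_coord hS₁ hD₁ m₁).comp l1⟩
  refine ⟨le_iInf₂ fun π hπ ↦ ?_, le_iInf₂ fun π hπ ↦ iInf₂_le π hπ.1, ?_⟩
  · obtain ⟨_, hX, hY⟩ := key π hπ
    rw [gwCost_eq hD₀.orthogonal hD₁.orthogonal hX hY ha0 hb0]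
    refine ENNReal.ofReal_le_ofReal ?_
    have h1 := integral_mul_sum_sq_le hX hY ha0 hb0 (norm_nonneg D₀) (norm_nonneg D₁)
      (frobenius_norm_sq_of_isDiag hD₀.isDiag) (frobenius_norm_sq_of_isDiag hD₁.isDiag)
    have h2 := sum_sq_crossCov_le hnm hX hY hD₀.antitone hD₁.antitone ha0 hb0
    rw [LGWSq_eq hnm hD₀.isDiag hD₁.isDiag, ← frobenius_norm_sq_of_isDiag hD₀.isDiag,
      ← frobenius_norm_sq_of_isDiag hD₁.isDiag]
    linarith
  -- The independent coupling is Gaussian and has finite cost.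
  · have hmem : (multivariateGaussian m₀ S₀).prod (multivariateGaussian m₁ S₁) ∈
        couplings (multivariateGaussian m₀ S₀) (multivariateGaussian m₁ S₁) :=
      ⟨by simp, by simp⟩
    obtain ⟨_, hX, hY⟩ := key _ hmem
    refine (iInf₂_le _ ⟨hmem, inferInstanceAs (IsGaussian _)⟩).trans_lt ?_
    rw [gwCost_eq hD₀.orthogonal hD₁.orthogonal hX hY ha0 hb0]
    exact ENNReal.ofReal_lt_top
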